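/- \textbf{Setting.} Let $\mathbf V$ be a finite set of endogenous variables, each variable $V$ having a fixed countable (discrete) domain $\mathscr D_V$; write $P(\mathbf s)=P(\mathbf S=\mathbf s)$. A \emph{causal diagram} $\mathcal G$ over $\mathbf V$ consists of an acyclic set of directed arrows, a set of bi-directed arrows between distinct nodes, and a partition of $\mathbf V$ into observed variables $\mathbf O$ and latent variables $\mathbf L$. A \emph{partially observable structural causal model} (POSCM) $M$ has finitely many mutually independent exogenous variables $\mathbf U$ (with arbitrary domains and distributions), a partition $\mathbf V=\mathbf O\cup\mathbf L$, and for each $V\in\mathbf V$ a measurable structural function $V\leftarrow f_V(\mathrm{Pa}_V,U_V)$ with $\mathrm{Pa}_V\subseteq\mathbf V$, $U_V\subseteq\mathbf U$, the relation $W\in \mathrm{Pa}_V$ being acyclic. Its diagram has $W\to V$ iff $W\in\mathrm{Pa}_V$, and $V\leftrightarrow W$ (for $V\ne W$) iff $U_V\cap U_W\neq\emptyset$, with the same observed and latent variables. $\mathbb M_{\langle\mathcal G\rangle}$ is the class of POSCMs with diagram $\mathcal G$, and $P(\mathbf v;M)$ is the distribution over $\mathbf V$ induced by $M$. For a distribution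 $P(\mathbf o)$ over $\mathbf O$, put $\mathbb M_{\langle\mathcal G,P\rangle}=\{M\in\mathbb M_{\langle\mathcal G\rangle}: P(\mathbf o;M)=P(\mathbf o)\}$. Fix an observed action $X\in\mathbf O$ and a latent reward $Y\in\mathbf L$ that is a descendant of $X$ in $\mathcal G$. A \emph{policy space} $\Pi$ is given by a set of covariates $\mathrm{Pa}(\Pi)\subseteq\mathbf O\setminus \mathrm{De}(X)_{\mathcal G_{\overline X}}$ (where $\mathrm{De}(X)$ includes $X$ and $\mathcal G_{\overline X}$ is $\mathcal G$ without arrows into $X$), and consists of all maps $\pi$ from values of $\mathrm{Pa}(\Pi)$ to probability distributions over $\mathscr D_X$. A policy space $\Pi'$ is a \emph{subspace} of $\Pi$ if $\mathrm{Pa}(\Pi')\subseteq \mathrm{Pa}(\Pi)$; its policies are regarded as policies in $\Pi$ that ignore the remaining covariates. The interventional distribution is $$P(\mathbf v\mid \mathrm{do}(\pi);M)=\sum_{\mathbf u}P(\mathbf u)\prod_{V\in\mathbf V\setminus\{X\}}P(v\mid \mathrm{pa}_V,u_V)\;\pi(x\mid \mathrm{pa}(\Pi))$$ (an integral if $\mathbf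 U$ is not discrete), and $P(\mathbf s\mid \mathrm{do}(\pi);M)$ is its marginal over $\mathbf S\subseteq\mathbf V$. \textbf{Definitions.} \begin{itemize} \item For $\mathbf S\subseteq\mathbf V$, a policy $\pi\in\Pi$ is an \emph{imitating policy} for $P(\mathbf s)$ w.r.t. $\langle\mathcal G,\Pi,P(\mathbf o)\rangle$ if $P(\mathbf s\mid\mathrm{do}(\pi);M)=P(\mathbf s;M)$ for all $M\in\mathbb M_{\langle\mathcal G,P\rangle}$. $P(\mathbf s)$ is \emph{p-imitable} w.r.t. $\langle\mathcal G,\Pi,P(\mathbf o)\rangle$ if such a policy exists. \item $P(\mathbf s\mid\mathrm{do}(\pi))$ is \emph{identifiable} w.r.t. $\langle\mathcal G,\Pi\rangle$ if $P(\mathbf s\mid\mathrm{do}(\pi);M_1)=P(\mathbf s\mid\mathrm{do}(\pi);M_2)$ for all $\pi\in\Pi$ and all $M_1,M_2\in\mathbb M_{\langle\mathcal G\rangle}$ with $P(\mathbf o;M_1)=P(\mathbf o;M_2)>0$ for every $\mathbf o$. \item $\mathbf S\subseteq\mathbf O$ is a \emph{surrogate} w.r.t. $\langle\mathcal G,\Pi\rangle$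 if $\mathbf S$ d-separates $Y$ from $\hat X$ in $\mathcal G\cup\Pi$, the graph obtained from $\mathcal G$ by adding arrows from $\mathrm{Pa}(\Pi)$ to $X$ and a new parent $\hat X$ of $X$. That is, every path (without repeated nodes) between $Y$ and $\hat X$ contains an inner node that is a non-collider in $\mathbf S$, or a collider such that neither it nor any of its descendants is in $\mathbf S$. \item $\langle\mathbf S,\Pi'\rangle$ is an \emph{imitation instrument} w.r.t. $\langle\mathcal G,\Pi\rangle$ if $\Pi'$ is a subspace of $\Pi$, $\mathbf S\subseteq\mathbf O$ is a surrogate w.r.t. $\langle\mathcal G,\Pi'\rangle$, and $P(\mathbf s\mid\mathrm{do}(\pi))$ is identifiable w.r.t. $\langle\mathcal G,\Pi'\rangle$. \end{itemize} \textbf{Lemma.} Given a causal diagram $\mathcal G$, a policy space $\Pi$ and an observational distribution $P(\mathbf o)$, let $\langle\mathbf S,\Pi'\rangle$ be an imitation instrument w.r.t. $\langle\mathcal G,\Pi\rangle$. If $P(\mathbf s)$ is p-imitable w.r.t. $\langle\mathcal G,\Pi',P(\mathbf o)\rangle$, then $P(y)$ is p-imitable w.r.t. $\langle\mathcal G,\Pi,P(\mathbf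 o)\rangle$. Moreover, every imitating policy $\pi$ for $P(\mathbf s)$ w.r.t. $\langle\mathcal G,\Pi',P(\mathbf o)\rangle$ is also an imitating policy for $P(y)$ w.r.t. $\langle\mathcal G,\Pi,P(\mathbf o)\rangle$. -/

import Mathlib

open MeasureTheory
open scoped ENNReal

universe u v w

/-- A graph with directed edges `a → b` and bi-directed edges `a ↔ b`. -/
structure MixedGraph (N : Type u) where
  /-- `dir a b` means `a → b`. -/
  dir : N → N → Prop
  /-- `bi a b` means `a ↔ b`. -/
  bi : N → N → Prop
  bi_symm : ∀ a b, bi a b → bi b a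

/-- How an edge of a path is traversed from its left end `a` to its right end `b`:
`a → b`, `a ← b` or `a ↔ b`. -/
inductive EdgeKind
  | fwd
  | bwd
  | bid

/-- The edge has an arrowhead at its right end. -/
def EdgeKind.HeadRight : EdgeKind → Prop
  | .fwd => True
  | .bwd => False
  | .bid => True

/-- The edge has an arrowhead at its left end. -/
def EdgeKind.HeadLeft : EdgeKind → Prop
  | .fwd => False
  | .bwd => True
  | .bid => True

namespace MixedGraph

variable {N : Type u}

/-- `a` and `b` are joined by an edge of the given kind, read from `a` to `b`. -/
def HasEdge (G : MixedGraph N) : EdgeKind → N → N → Prop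
  | .fwd, a, b => G.dir a b
  | .bwd, a, b => G.dir b a
  | .bid, a, b => G.bi a b

/-- Descendants of `a`, with `a` included. -/
def De (G : MixedGraph N) (a : N) : Set N :=
  {b | Relation.ReflTransGen G.dir a b}

/-- The graph with all arrowheads into `a` removed. -/
def removeInto (G : MixedGraph N) (a : N) : MixedGraph N where
  dir b c := G.dir b c ∧ c ≠ a
  bi b c := G.bi b c ∧ b ≠ a ∧ c ≠ a
  bi_symm b c h := ⟨G.bi_symm b c h.1, h.2.2, h.2.1⟩

/-- A path from `a` to `b`: a sequence of edges, the `i`-th one joining `node i` to `node (i + 1)`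
for `i < len`, that visits no node more than once. Values of `node` beyond `len` and of `kind` from
`len` on carry no information. -/
structure Path (G : MixedGraph N) (a b : N) where
  len : ℕ
  node : ℕ → N
  kind : ℕ → EdgeKind
  node_zero : node 0 = a
  node_len : node len = b
  edge : ∀ i < len, G.HasEdge (kind i) (node i) (node (i + 1))
  nodup : Set.InjOn node (Set.Iic len)

/-- The inner node `node (i + 1)` of the path is a collider: both adjacent edges point at it. -/
def Path.Collider {G : MixedGraph N} {a b : N} (p : G.Path a b) (i : ℕ) : Prop :=
  (p.kind i).HeadRight ∧ (p.kind (i + 1)).HeadLeft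

/-- A path is blocked by `Z` if it has an inner node that is either a non-collider in `Z`, or a
collider such that neither it nor any of its descendants is in `Z`. -/
def Path.Blocked {G : MixedGraph N} {a b : N} (p : G.Path a b) (Z : Set N) : Prop :=
  ∃ i, i + 1 < p.len ∧
    ((¬ p.Collider i ∧ p.node (i + 1) ∈ Z) ∨
      (p.Collider i ∧ ∀ d ∈ G.De (p.node (i + 1)), d ∉ Z))

/-- `A` and `B` are d-separated by `Z`. -/
def DSep (G : MixedGraph N) (A B Z : Set N) : Prop :=
  ∀ a ∈ A, ∀ b ∈ B, ∀ p : G.Path a b, p.Blocked Z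

end MixedGraph

/-- A causal diagram: an acyclic graph over the endogenous variables `V`, with bi-directed arrows
for unobserved confounders, and the set of its observed (solid) nodes. The other nodes are
latent. -/
structure CausalDiagram (V : Type u) extends MixedGraph V where
  acyclic : ∀ a, ¬ Relation.TransGen dir a a
  bi_irrefl : ∀ a, ¬ bi a a
  obs : Set V

/-- A partially observable (recursive) structural causal model over endogenous variables `V` with
domains `dom`. The exogenous variables are mutually independent; dependence between the
disturbances of two endogenous variables is expressed by shared exogenous variables. -/
structure POSCM (V : Type u) (dom : V → Type v) where
  /-- The (finite) set of exogenous variables. -/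
  U : Type w
  [fintypeU : Fintype U]
  /-- Domains of the exogenous variables. -/
  Udom : U → Type w
  [measurableSpaceU : ∀ i, MeasurableSpace (Udom i)]
  /-- Distributions of the exogenous variables. -/
  PU : ∀ i, Measure (Udom i)
  [probU : ∀ i, IsProbabilityMeasure (PU i)]
  /-- Endogenous arguments of the structural functions. -/
  pa : V → Set V
  /-- Exogenous arguments of the structural functions. -/
  exo : V → Set U
  /-- The structural functions. -/
  f : ∀ a, (∀ p : pa a, dom p) → (∀ i : exo a, Udom i) → dom a
  measurable_f : ∀ a (p : ∀ p : pa a, dom p) (c : dom a), MeasurableSet {e | f a p e = c}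
  acyclic : ∀ a, ¬ Relation.TransGen (fun b c => b ∈ pa c) a a
  /-- Observed endogenous variables. -/
  obs : Set V

attribute [instance] POSCM.fintypeU POSCM.measurableSpaceU POSCM.probU

section

variable {V : Type u} {dom : V → Type v}

/-- A function on full assignments, summed over the variables outside `S`: the marginal over `S`
of a distribution given by its point probabilities. -/
noncomputable def marginal (S : Set V) (P : (∀ a, dom a) → ℝ≥0∞) : (∀ a : S, dom a) → ℝ≥0∞ :=
  fun s => ∑' t : {t : ∀ a, dom a // S.domRestrict t = s}, P t

namespace POSCM

/-- The exogenous distribution `P(u)`. -/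
noncomputable def exoMeasure (M : POSCM.{u, v, w} V dom) : Measure (∀ i, M.Udom i) :=
  Measure.pi M.PU

/-- The assignment `t` satisfies the structural equation of `a` at the exogenous values `e`. -/
def Satisfies (M : POSCM.{u, v, w} V dom) (e : ∀ i, M.Udom i) (t : ∀ a, dom a) (a : V) : Prop :=
  t a = M.f a ((M.pa a).domRestrict t) ((M.exo a).domRestrict e)

/-- Point probabilities `P(v; M)`: the probability that `t` solves all structural equations. -/
noncomputable def dist (M : POSCM.{u, v, w} V dom) (t : ∀ a, dom a) : ℝ≥0∞ :=
  M.exoMeasure {e | ∀ a, M.Satisfies e t a}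

/-- The causal diagram of a model. -/
def diagram (M : POSCM.{u, v, w} V dom) : CausalDiagram V where
  dir a b := a ∈ M.pa b
  bi a b := a ≠ b ∧ (M.exo a ∩ M.exo b).Nonempty
  bi_symm a b h := ⟨h.1.symm, by rw [Set.inter_comm]; exact h.2⟩
  acyclic := M.acyclic
  bi_irrefl a h := h.1 rfl
  obs := M.obs

end POSCM

/-- A policy space over the action `x`, given by its set of input covariates, which are observed
non-descendants of `x`. -/
structure PolicySpace (G : CausalDiagram V) (x : V) where
  Pa : Set V
  subset : Pa ⊆ G.obs \ (G.removeInto x).De x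

namespace PolicySpace

variable {G : CausalDiagram V} {x : V}

/-- The policies in the space: maps from covariate values to distributions over the action. -/
def Policy (R : PolicySpace G x) (dom : V → Type v) : Type (max u v) :=
  (∀ z : R.Pa, dom z) → PMF (dom x)

/-- `R'` is a subspace of `R`. -/
def IsSubspace (R' R : PolicySpace G x) : Prop := R'.Pa ⊆ R.Pa

/-- A policy of a subspace, as a policy of the whole space that ignores the other covariates. -/
def extend {R' R : PolicySpace G x} (h : R'.IsSubspace R) (π : R'.Policy dom) : R.Policy dom :=
  fun z => π fun a => z ⟨a.1, h a.2⟩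

/-- The graph `G ∪ Π` (arrows from the covariates to `x` are added) together with a new parent
`X̂` of `x`. The node `X̂` is `none`. -/
def augmented (R : PolicySpace G x) : MixedGraph (Option V) where
  dir
    | some a, some b => G.dir a b ∨ (a ∈ R.Pa ∧ b = x)
    | none, some b => b = x
    | _, none => False
  bi
    | some a, some b => G.bi a b
    | _, _ => False
  bi_symm
    | some a, some b => G.bi_symm a b
    | some _, none => id
    | none, some _ => id
    | none, none => id

end PolicySpace

/-- Point probabilities `P(v | do(π); M)`: the factor of the action `x` is replaced by the
policy. -/
noncomputable def POSCM.doDist {G : CausalDiagram V} {x : V} (M : POSCM.{u, v, w} V dom)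
    {R : PolicySpace G x} (π : R.Policy dom) (t : ∀ a, dom a) : ℝ≥0∞ :=
  M.exoMeasure {e | ∀ a, a ≠ x → M.Satisfies e t a} * π (R.Pa.domRestrict t) (t x)

variable {G : CausalDiagram V} {x : V}

/-- `P(s | do(π))` is identifiable w.r.t. `⟨G, Π⟩`: for every policy in the space it is determined
by any positive observational distribution. -/
def Identifiable (dom : V → Type v) (R : PolicySpace G x) (S : Set V) : Prop :=
  ∀ M₁ M₂ : POSCM.{u, v, w} V dom, M₁.diagram = G → M₂.diagram = G →
    marginal G.obs M₁.dist = marginal G.obs M₂.dist →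
    (∀ o, 0 < marginal G.obs M₁.dist o) →
    ∀ π : R.Policy dom, marginal S (M₁.doDist π) = marginal S (M₂.doDist π)

/-- `π` is an imitating policy for `P(s)` w.r.t. `⟨G, Π, P(o)⟩`: `P(s | do(π); M) = P(s; M)` in all
models `M` that induce `G` and `P(o)`. -/
def IsImitating {R : PolicySpace G x} (P : PMF (∀ a : G.obs, dom a)) (S : Set V)
    (π : R.Policy dom) : Prop :=
  ∀ M : POSCM.{u, v, w} V dom, M.diagram = G → marginal G.obs M.dist = P →
    marginal S (M.doDist π) = marginal S M.dist

/-- `P(s)` is p-imitable w.r.t. `⟨G, Π, P(o)⟩`. -/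
def PImitable (R : PolicySpace G x) (P : PMF (∀ a : G.obs, dom a)) (S : Set V) : Prop :=
  ∃ π : R.Policy dom, IsImitating.{u, v, w} P S π

/-- `S` is an imitation surrogate w.r.t. `⟨G, Π⟩` and the reward `y`: it consists of observed
variables and d-separates `y` from `X̂` in `G ∪ Π`. -/
def IsSurrogate (R : PolicySpace G x) (y : V) (S : Set V) : Prop :=
  S ⊆ G.obs ∧ R.augmented.DSep {some y} {none} (some '' S)

/-- `R'` is an identifiable subspace w.r.t. `⟨G, R, S⟩`. -/
def IsIdSubspace (dom : V → Type v) (R : PolicySpace G x) (S : Set V) (R' : PolicySpace G x) :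
    Prop :=
  R'.IsSubspace R ∧ Identifiable.{u, v, w} dom R' S

/-- `⟨S, R'⟩` is an imitation instrument w.r.t. `⟨G, R⟩` and the reward `y`. -/
structure IsInstrument (dom : V → Type v) (R : PolicySpace G x) (y : V) (S : Set V)
    (R' : PolicySpace G x) : Prop where
  surrogate : IsSurrogate R' y S
  idSubspace : IsIdSubspace.{u, v, w} dom R S R'

end

/-!
The graph `G ∪ Π` with the extra parent `X̂` of the action describes a single experiment in which `X̂`
chooses between the natural mechanism of the action and the policy. If a surrogate `S` separates the
reward `y` from `X̂`, then the law of `y` given `S` is the same under both mechanisms; hence a policy that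
reproduces the law of `S` in a model also reproduces the law of `y` in that model.

The conditional independence is derived directly. Among the ancestors of `S` and `y`, let `C` be the
set of variables connected to `X̂` by edges that are bi-directed or leave a node outside `S`. If `y`
were in `C`, a connection without repeated nodes could be rerouted into an unblocked path
(`MixedGraph.exists_path_not_blocked`), so `y` lies in the set `B` of the remaining ancestors
(`IsSurrogate.exists_partition`). The structural equations of `B` and of `C` share only variables in
`S` and have independent disturbances, so the probability that the solution takes given values on `S`
and at `y` is a factor coming from `C` times a factor coming from `B`
(`tsum_solution_eq_mul`). The action belongs to `C`, so that the second factor is the same in the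
observational and the interventional regime, and the first one is fixed by the law of `S` as
soon as the second one does not vanish (`marginal_eq_of_factor`).

A stochastic policy is treated as a mixture of deterministic policies, with independent choices at the
different covariate values (`POSCM.doDist_eq_lintegral`), so that only deterministic systems of
equations occur.
-/

/-! ### Reachability and unblocked paths -/

/-- A chain of related elements can be shortened to one without repetitions. -/
theorem exists_injOn_of_reflTransGen {N : Type u} {r : N → N → Prop} {a b : N}
    (h : Relation.ReflTransGen r a b) :
    ∃ (n : ℕ) (f : ℕ → N), f 0 = a ∧ f n = b ∧ (∀ i < n, r (f i) (f (i + 1))) ∧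
      Set.InjOn f (Set.Iic n) := by
  induction h using Relation.ReflTransGen.head_induction_on with
  | refl => exact ⟨0, fun _ => b, rfl, rfl, by simp, fun i hi j hj _ => by simp_all⟩
  | @head a c hac _ ih =>
    obtain ⟨n, f, h0, hn, hr, hf⟩ := ih
    by_cases ha : ∃ i ≤ n, f i = a
    · -- `a` already occurs on the chain: cut off everything before it
      obtain ⟨i, hi, rfl⟩ := ha
      refine ⟨n - i, fun k => f (k + i), by simp, by simp [hi, hn], fun k hk => ?_,
        fun j hj k hk hjk => ?_⟩
      · have := hr (k + i) (by omega)
        rwa [show k + i + 1 = k + 1 + i by omega] at this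
      · simp only [Set.mem_Iic] at hj hk
        have := hf (show j + i ∈ Set.Iic n by simp only [Set.mem_Iic]; omega)
          (show k + i ∈ Set.Iic n by simp only [Set.mem_Iic]; omega) hjk
        omega
    · push Not at ha
      refine ⟨n + 1, fun k => k.casesOn a f, rfl, hn, fun k hk => ?_, fun j hj k hk hjk => ?_⟩
      · cases k with
        | zero => simpa [h0] using hac
        | succ k => exact hr k (by omega)
      · simp only [Set.mem_Iic] at hj hk
        cases j with
        | zero =>
          cases k with
          | zero => rfl
          | succ k => exact absurd hjk.symm (ha k (by omega))
        | succ j =>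
          cases k with
          | zero => exact absurd hjk (ha j (by omega))
          | succ k =>
            have := hf (show j ∈ Set.Iic n by simp only [Set.mem_Iic]; omega)
              (show k ∈ Set.Iic n by simp only [Set.mem_Iic]; omega) hjk
            omega

namespace MixedGraph

variable {N : Type u}

/-- Ancestors of nodes in `Z`, with `Z` included. -/
def An (G : MixedGraph N) (Z : Set N) : Set N :=
  {a | ∃ b ∈ Z, b ∈ G.De a}

theorem subset_An (G : MixedGraph N) (Z : Set N) : Z ⊆ G.An Z :=
  fun a ha => ⟨a, ha, .refl⟩

theorem An_of_dir {G : MixedGraph N} {Z : Set N} {a b : N} (hb : b ∈ G.An Z) (h : G.dir a b) :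
    a ∈ G.An Z := by
  obtain ⟨c, hc, hbc⟩ := hb
  exact ⟨c, hc, .head h hbc⟩

/-- `a` and `b` are nodes of `A` joined by a bi-directed edge, or by a directed edge whose tail is
not in `Z`. Walks made of such steps have no non-collider in `Z`. -/
def ActiveStep (G : MixedGraph N) (Z A : Set N) (a b : N) : Prop :=
  a ∈ A ∧ b ∈ A ∧ (G.bi a b ∨ (G.dir a b ∧ a ∉ Z) ∨ (G.dir b a ∧ b ∉ Z))

/-- Nodes connected by active steps among the ancestors of `Z` and `y` are not d-separated.

A collider on the walk that is not an ancestor of `Z` is an ancestor of `y`. At the first such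
node the walk is replaced by a directed path to `y`, which meets neither `Z` nor the part of the walk
before it. -/
theorem exists_path_not_blocked (G : MixedGraph N) {Z : Set N} {y z : N}
    (h : Relation.ReflTransGen (G.ActiveStep Z (G.An (insert y Z))) z y) :
    ∃ p : G.Path y z, ¬ p.Blocked Z := by
  -- outside the ancestors of `Z` only directed edges towards `y` are allowed
  let r : N → N → Prop := fun a b =>
    (a ∈ G.An Z ∧ G.ActiveStep Z (G.An (insert y Z)) a b) ∨ (a ∉ G.An Z ∧ G.dir a b)
  have hdir : ∀ a, a ∉ G.An Z → Relation.ReflTransGen G.dir a y → Relation.ReflTransGen r a y := by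
    intro a ha hay
    induction hay using Relation.ReflTransGen.head_induction_on with
    | refl => exact .refl
    | head hac _ ih => exact .head (.inr ⟨ha, hac⟩) (ih fun hc => ha (An_of_dir hc hac))
  have hr : Relation.ReflTransGen r z y := by
    induction h using Relation.ReflTransGen.head_induction_on with
    | refl => exact .refl
    | @head a c hac _ ih =>
      by_cases ha : a ∈ G.An Z
      · exact .head (.inl ⟨ha, hac⟩) ih
      · obtain ⟨b, hb, hab⟩ := hac.1
        rcases hb with rfl | hb
        · exact hdir a ha hab
        · exact absurd ⟨b, hb, hab⟩ ha
  obtain ⟨n, f, h0, hn, hf, hinj⟩ := exists_injOn_of_reflTransGen hr.swap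
  have hkind : ∀ a b, r b a → ∃ k : EdgeKind, G.HasEdge k a b ∧ (k.HeadRight → b ∈ G.An Z) ∧
      (¬ k.HeadRight → b ∉ Z) ∧ (¬ k.HeadLeft → a ∉ Z) := by
    rintro a b (⟨hb, -, -, h | ⟨h, hbZ⟩ | ⟨h, haZ⟩⟩ | ⟨hb, h⟩)
    · exact ⟨.bid, G.bi_symm _ _ h, by simp [EdgeKind.HeadRight, EdgeKind.HeadLeft, hb]⟩
    · exact ⟨.bwd, h, by simp [EdgeKind.HeadRight, EdgeKind.HeadLeft, hbZ]⟩
    · exact ⟨.fwd, h, by simp [EdgeKind.HeadRight, EdgeKind.HeadLeft, hb, haZ]⟩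
    · have hbZ : b ∉ Z := fun hbZ => hb (G.subset_An Z hbZ)
      exact ⟨.bwd, h, by simp [EdgeKind.HeadRight, EdgeKind.HeadLeft, hbZ]⟩
  have : Nonempty EdgeKind := ⟨.fwd⟩
  choose! k hk using hkind
  let p : G.Path y z :=
    { len := n
      node := f
      kind := fun i => k (f i) (f (i + 1))
      node_zero := h0
      node_len := hn
      edge := fun i hi => (hk _ _ (hf i hi)).1
      nodup := hinj }
  refine ⟨p, ?_⟩
  rintro ⟨i, hi, ⟨hc, hZ⟩ | ⟨hc, hZ⟩⟩
  · have hi' : i + 1 < n := hi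
    have h1 := (hk _ _ (hf i (by omega))).2.2.1
    have h2 := (hk _ _ (hf (i + 1) hi')).2.2.2
    by_cases hR : (k (f i) (f (i + 1))).HeadRight
    · exact h2 (fun hL => hc ⟨hR, hL⟩) hZ
    · exact h1 hR hZ
  · have hi' : i + 1 < n := hi
    obtain ⟨b, hb, hd⟩ := (hk _ _ (hf i (by omega))).2.1 hc.1
    exact hZ b hd hb

end MixedGraph

/-! ### Systems of structural equations -/

section

variable {V : Type u} {dom : V → Type v} {Ω : Type w}

/-- In an acyclic system of equations `t a = F a t`, the variables in `A` can be prescribed and the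
others are then determined. -/
theorem exists_solution_outside {r : V → V → Prop} (hr : WellFounded r)
    {F : ∀ a, (∀ a, dom a) → dom a}
    (hF : ∀ a t t', (∀ b, r b a → t b = t' b) → F a t = F a t')
    (A : Set V) (t₀ : ∀ a, dom a) :
    ∃ t : ∀ a, dom a, (∀ a ∈ A, t a = t₀ a) ∧ ∀ a ∉ A, t a = F a t := by
  classical
  let step : ∀ a, (∀ b, r b a → dom b) → dom a := fun a ih =>
    if a ∈ A then t₀ a else F a fun b => if h : r b a then ih b h else t₀ b
  have hfix := hr.fix_eq step
  refine ⟨hr.fix step, fun a ha => ?_, fun a ha => ?_⟩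
  · rw [hfix]; simp only [step, if_pos ha]
  · rw [hfix]; simp only [step, if_neg ha]
    exact hF a _ _ fun b hb => by simp only [dif_pos hb]

theorem solution_unique {r : V → V → Prop} (hr : WellFounded r)
    {F : ∀ a, (∀ a, dom a) → dom a}
    (hF : ∀ a t t', (∀ b, r b a → t b = t' b) → F a t = F a t')
    {t t' : ∀ a, dom a} (ht : ∀ a, t a = F a t) (ht' : ∀ a, t' a = F a t') : t = t' := by
  funext a
  induction a using hr.induction with
  | _ a ih => rw [ht, ht', hF a t t' ih]

/-- The outcomes for which the equations of the variables in `D` have a solution that lies in `K`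
and agrees with `s` on `S`. -/
def solvableEvent (F : ∀ a, (∀ a, dom a) → Ω → dom a) (S D : Set V) (K : Set (∀ a, dom a))
    (s : ∀ a : S, dom a) : Set Ω :=
  {ω | ∃ t ∈ K, S.domRestrict t = s ∧ ∀ a ∈ D, t a = F a t ω}

theorem measurableSet_solvableEvent [Finite V] [∀ a, Countable (dom a)] {m : MeasurableSpace Ω}
    {F : ∀ a, (∀ a, dom a) → Ω → dom a} (S : Set V) {D : Set V} (K : Set (∀ a, dom a))
    (s : ∀ a : S, dom a)
    (hF : ∀ a ∈ D, ∀ t c, MeasurableSet {ω | F a t ω = c}) :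
    MeasurableSet (solvableEvent F S D K s) := by
  have : solvableEvent F S D K s =
      ⋃ t ∈ {t | t ∈ K ∧ S.domRestrict t = s}, ⋂ a ∈ D, {ω | F a t ω = t a} := by
    ext ω
    simp [solvableEvent, and_assoc, eq_comm]
  rw [this]
  exact .biUnion (Set.to_countable _) fun t _ => .biInter (Set.to_countable _) fun a ha => hF a ha t _

/-- Factorization of the law of the solution. Let `B` and `C` be two groups of variables that
interact only through the variables in `S`, and whose disturbances are independent. Then the
probability that the solution is `s` on `S` and lies in an event `K` about `S ∪ B` is a product of a
factor that depends on the equations of `C` and `s` only, and a factor that depends on the equations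
of `B`, `s` and `K` only. -/
theorem tsum_solution_eq_mul [Finite V] [∀ a, Countable (dom a)] {mΩ : MeasurableSpace Ω}
    {μ : Measure Ω} {mB mC : MeasurableSpace Ω}
    (hind : ProbabilityTheory.Indep mC mB μ)
    {r : V → V → Prop} (hr : WellFounded r) {F : ∀ a, (∀ a, dom a) → Ω → dom a}
    (hF : ∀ ω a t t', (∀ b, r b a → t b = t' b) → F a t ω = F a t' ω)
    (hFm : ∀ a t c, MeasurableSet[mΩ] {ω | F a t ω = c})
    {S B C : Set V} (hBC : Disjoint B C) (hS : S ⊆ B ∪ C)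
    (hFB : ∀ a ∈ B, ∀ t c, MeasurableSet[mB] {ω | F a t ω = c})
    (hFC : ∀ a ∈ C, ∀ t c, MeasurableSet[mC] {ω | F a t ω = c})
    (hB : ∀ a ∈ B, ∀ b, r b a → b ∈ S ∪ B) (hC : ∀ a ∈ C, ∀ b, r b a → b ∈ S ∪ C)
    {K : Set (∀ a, dom a)} (hK : ∀ t t', (∀ a ∈ S ∪ B, t a = t' a) → t ∈ K → t' ∈ K)
    (s : ∀ a : S, dom a) :
    ∑' t : {t // t ∈ K ∧ S.domRestrict t = s}, μ {ω | ∀ a, t.1 a = F a t.1 ω} =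
      μ (solvableEvent F S C Set.univ s) * μ (solvableEvent F S B K s) := by
  classical
  rw [← (ProbabilityTheory.Indep_iff _ _ _).1 hind _ _
    (measurableSet_solvableEvent (m := mC) S Set.univ s hFC)
    (measurableSet_solvableEvent (m := mB) S K s hFB), ← measure_iUnion]
  · congr 1
    ext ω
    simp only [Set.mem_iUnion, Set.mem_ofPred_eq, Set.mem_inter_iff]
    constructor
    · rintro ⟨⟨t, hK, hs⟩, ht⟩
      exact ⟨⟨t, trivial, hs, fun a _ => ht a⟩, ⟨t, hK, hs, fun a _ => ht a⟩⟩
    · rintro ⟨⟨tC, -, hsC, htC⟩, ⟨tB, hKB, hsB, htB⟩⟩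
      -- glue the two partial solutions and solve the remaining equations
      obtain ⟨t, ht, ht'⟩ := exists_solution_outside hr (hF ω) (B ∪ C)
        (fun a => if a ∈ B then tB a else tC a)
      have hSS : ∀ a ∈ S, tB a = tC a := fun a ha => by
        have := congrFun (hsB.trans hsC.symm) ⟨a, ha⟩
        simpa using this
      have hB' : ∀ a ∈ B, t a = tB a := fun a ha => by rw [ht a (.inl ha), if_pos ha]
      have hC' : ∀ a ∈ C, t a = tC a := fun a ha => by
        rw [ht a (.inr ha), if_neg (Set.disjoint_right.1 hBC ha)]
      have hSB : ∀ a ∈ S ∪ B, t a = tB a := by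
        rintro a (ha | ha)
        · rcases hS ha with h | h
          · exact hB' a h
          · rw [hC' a h, hSS a ha]
        · exact hB' a ha
      have hSC : ∀ a ∈ S ∪ C, t a = tC a := by
        rintro a (ha | ha)
        · rw [hSB a (.inl ha), hSS a ha]
        · exact hC' a ha
      refine ⟨⟨t, hK tB t (fun a ha => (hSB a ha).symm) hKB, ?_⟩, fun a => ?_⟩
      · rw [← hsB]
        funext a
        exact hSB a (Set.mem_union_left B a.2)
      · change t a = F a t ω
        by_cases haB : a ∈ B
        · rw [hB' a haB, htB a haB]
          exact hF ω a _ _ fun b hb => (hSB b (hB a haB b hb)).symm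
        by_cases haC : a ∈ C
        · rw [hC' a haC, htC a haC]
          exact hF ω a _ _ fun b hb => (hSC b (hC a haC b hb)).symm
        exact ht' a (by simp [haB, haC])
  · intro t t' htt
    refine Set.disjoint_left.2 fun ω h h' => htt (Subtype.ext ?_)
    exact solution_unique hr (hF ω) h h'
  · intro t
    have : {ω | ∀ a, t.1 a = F a t.1 ω} = ⋂ a, {ω | F a t.1 ω = t.1 a} := by
      ext ω; simp [eq_comm]
    rw [this]
    exact .iInter fun a => hFm a _ _

end

/-! ### Separation of the action and the reward by a surrogate -/

section

variable {V : Type u} {G : CausalDiagram V} {x : V}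

namespace PolicySpace

/-- The direct arguments of the variables when the action may also listen to the covariates. -/
def Arg (R : PolicySpace G x) (b a : V) : Prop :=
  G.dir b a ∨ (b ∈ R.Pa ∧ a = x)

theorem wellFounded_arg [Finite V] (R : PolicySpace G x) : WellFounded R.Arg := by
  -- a directed path from `x` never returns to `x`, so it survives the removal of arrows into `x`
  have hPa : ∀ z ∈ R.Pa, ¬ Relation.ReflTransGen G.dir x z := by
    intro z hz hxz
    refine (R.subset hz).2 ?_
    change Relation.ReflTransGen (G.removeInto x).dir x z
    clear hz
    induction hxz with
    | refl => exact .refl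
    | @tail b c hxb hbc ih =>
      refine .tail ih ⟨hbc, ?_⟩
      rintro rfl
      exact G.acyclic _ (Relation.TransGen.tail' hxb hbc)
  -- a chain of arguments that uses a new arrow `z → x` goes through a covariate and through `x`
  have key : ∀ a b, Relation.TransGen R.Arg a b → Relation.TransGen G.dir a b ∨
      ((∃ z ∈ R.Pa, Relation.ReflTransGen G.dir a z) ∧ Relation.ReflTransGen G.dir x b) := by
    intro a b hab
    induction hab with
    | single h =>
      rcases h with h | ⟨h, rfl⟩
      · exact .inl (.single h)
      · exact .inr ⟨⟨_, h, .refl⟩, .refl⟩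
    | tail _ h ih =>
      rcases h with h | ⟨h, rfl⟩
      · rcases ih with ih | ⟨hz, ih⟩
        · exact .inl (ih.tail h)
        · exact .inr ⟨hz, ih.tail h⟩
      · rcases ih with ih | ⟨hz, ih⟩
        · exact .inr ⟨⟨_, h, ih.to_reflTransGen⟩, .refl⟩
        · exact .inr ⟨hz, .refl⟩
  have hirr : Std.Irrefl (Relation.TransGen R.Arg) := ⟨fun a ha => by
    rcases key a a ha with h | ⟨⟨z, hz, haz⟩, hxa⟩
    · exact G.acyclic a h
    · exact hPa z hz (hxa.trans haz)⟩
  exact Subrelation.wf (fun h => Relation.TransGen.single h)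
    (Finite.wellFounded_of_trans_of_irrefl (Relation.TransGen R.Arg))

end PolicySpace

/-- Among the ancestors of `S` and `y`, let `C` consist of the variables connected to `X̂` by active
steps, and `B` of the others. These groups interact only through `S`. -/
theorem IsSurrogate.exists_partition {R : PolicySpace G x} {y : V} {S : Set V}
    (h : IsSurrogate R y S) (hxy : y ∈ G.De x) :
    ∃ B C : Set V, Disjoint B C ∧ S ⊆ B ∪ C ∧ x ∈ C ∧ y ∈ B ∧
      (∀ a ∈ B, ∀ b ∈ C, ¬ G.bi b a) ∧ (∀ a ∈ B, ∀ b, G.dir b a → b ∈ S ∪ B) ∧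
      ∀ a ∈ C, ∀ b, R.Arg b a → b ∈ S ∪ C := by
  set A := R.augmented.An (insert (some y) (some '' S)) with hA
  let step := R.augmented.ActiveStep (some '' S) A
  let C : Set V := {a | Relation.ReflTransGen step none (some a)}
  have hCA : ∀ a ∈ C, some a ∈ A := by
    intro a ha
    obtain h | ⟨b, -, hb⟩ := Relation.ReflTransGen.cases_tail ha
    · cases h
    · exact hb.2.1
  have hxA : some x ∈ A := by
    refine ⟨some y, Set.mem_insert _ _, ?_⟩
    exact Relation.ReflTransGen.lift (p := R.augmented.dir) some (fun a b hab => Or.inl hab) _ _ hxy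
  have hS : ∀ b, some b ∉ some '' S ↔ b ∉ S := by simp
  refine ⟨{a | some a ∈ A ∧ a ∉ C}, C, ?_, ?_, ?_, ?_, ?_, ?_, ?_⟩
  · exact Set.disjoint_left.2 fun a ha => ha.2
  · intro a ha
    by_cases haC : a ∈ C
    · exact .inr haC
    · exact .inl ⟨R.augmented.subset_An _ (.inr ⟨a, ha, rfl⟩), haC⟩
  · have hdir : R.augmented.dir none (some x) := rfl
    exact .single ⟨MixedGraph.An_of_dir hxA hdir, hxA, .inr (.inl ⟨hdir, by simp⟩)⟩
  · refine ⟨R.augmented.subset_An _ (.inl rfl), fun hy => ?_⟩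
    obtain ⟨p, hp⟩ := R.augmented.exists_path_not_blocked hy
    exact hp (h.2 _ rfl _ rfl p)
  · rintro a ⟨haA, haC⟩ b hb hba
    exact haC (Relation.ReflTransGen.tail hb ⟨hCA b hb, haA, .inl hba⟩)
  · rintro a ⟨haA, haC⟩ b hba
    have hdir : R.augmented.dir (some b) (some a) := .inl hba
    by_cases hbS : b ∈ S
    · exact .inl hbS
    refine .inr ⟨MixedGraph.An_of_dir haA hdir, fun hb => haC ?_⟩
    exact Relation.ReflTransGen.tail hb ⟨hCA b hb, haA, .inr (.inl ⟨hdir, (hS b).2 hbS⟩)⟩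
  · intro a ha b hba
    have hdir : R.augmented.dir (some b) (some a) := hba
    by_cases hbS : b ∈ S
    · exact .inl hbS
    refine .inr (Relation.ReflTransGen.tail ha ⟨hCA a ha, MixedGraph.An_of_dir (hCA a ha) hdir, ?_⟩)
    exact .inr (.inr ⟨hdir, (hS b).2 hbS⟩)

end

/-! ### Observational and interventional distributions as laws of solutions -/

namespace POSCM

variable {V : Type u} {dom : V → Type v} (M : POSCM.{u, v, w} V dom)

/-- The structural functions, as functions of full assignments and all exogenous values. -/
def mech (a : V) (t : ∀ a, dom a) (e : ∀ i, M.Udom i) : dom a :=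
  M.f a ((M.pa a).domRestrict t) ((M.exo a).domRestrict e)

/-- The σ-algebra generated by the exogenous variables in `K`. -/
abbrev exoSigma (K : Set M.U) : MeasurableSpace (∀ i, M.Udom i) :=
  ⨆ i ∈ K, (M.measurableSpaceU i).comap fun e => e i

theorem exoSigma_le (K : Set M.U) : M.exoSigma K ≤ MeasurableSpace.pi :=
  iSup₂_le fun i _ => (measurable_pi_apply i).comap_le

theorem indep_exoSigma {K L : Set M.U} (h : Disjoint K L) :
    ProbabilityTheory.Indep (M.exoSigma K) (M.exoSigma L) M.exoMeasure := by
  have hi : ProbabilityTheory.iIndepFun (fun i (e : ∀ i, M.Udom i) => e i) M.exoMeasure :=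
    ProbabilityTheory.iIndepFun_pi (X := fun _ => id) fun _ => aemeasurable_id
  exact ProbabilityTheory.indep_iSup_of_disjoint
    (fun i => (measurable_pi_apply i).comap_le) hi h

theorem measurableSet_mech {a : V} {K : Set M.U} (hK : M.exo a ⊆ K) (t : ∀ a, dom a) (c : dom a) :
    MeasurableSet[M.exoSigma K] {e | M.mech a t e = c} := by
  have hm : @Measurable _ _ (M.exoSigma K) _ ((M.exo a).domRestrict (π := M.Udom)) := by
    refine @measurable_pi_lambda _ _ _ (M.exoSigma K) _ _ fun i => ?_
    refine Measurable.of_comap_le ?_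
    exact le_iSup₂ (f := fun i (_ : i ∈ K) => (M.measurableSpaceU i).comap fun e : ∀ i, M.Udom i => e i)
      i.1 (hK i.2)
  exact hm (M.measurable_f a ((M.pa a).domRestrict t) c)

instance : IsProbabilityMeasure M.exoMeasure := by
  unfold exoMeasure; infer_instance

open Classical in
/-- The structural functions with that of `x` replaced by the deterministic policy `g`. -/
noncomputable def detMech {x : V} (Z : Set V) (g : (∀ z : Z, dom z) → dom x) (a : V) :
    (∀ a, dom a) → (∀ i, M.Udom i) → dom a :=
  Function.update M.mech x (fun t _ => g (Z.domRestrict t)) a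

theorem detMech_self {x : V} (Z : Set V) (g : (∀ z : Z, dom z) → dom x) (t e) :
    M.detMech Z g x t e = g (Z.domRestrict t) := by
  simp [detMech]

theorem detMech_of_ne {x a : V} (h : a ≠ x) (Z : Set V) (g : (∀ z : Z, dom z) → dom x) :
    M.detMech Z g a = M.mech a := by
  simp [detMech, h]

open Classical in
theorem exoMeasure_detMech {x : V} (Z : Set V) (g : (∀ z : Z, dom z) → dom x) (t : ∀ a, dom a) :
    M.exoMeasure {e | ∀ a, t a = M.detMech Z g a t e} =
      if g (Z.domRestrict t) = t x then M.exoMeasure {e | ∀ a, a ≠ x → M.Satisfies e t a} else 0 := by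
  split_ifs with hg
  · congr 1
    ext e
    refine ⟨fun h a ha => ?_, fun h a => ?_⟩
    · have := h a
      rwa [detMech_of_ne M ha] at this
    · by_cases ha : a = x
      · subst ha; rw [detMech_self, hg]
      · rw [detMech_of_ne M ha]; exact h a ha
  · convert measure_empty (μ := M.exoMeasure)
    refine Set.eq_empty_of_forall_notMem fun e he => hg ?_
    have := he x
    rw [detMech_self] at this
    exact this.symm

/-- The σ-algebra on deterministic policies generated by the actions at each covariate value. -/
abbrev detPolicySigma (dom : V → Type v) (x : V) (Z : Set V) :
    MeasurableSpace ((∀ z : Z, dom z) → dom x) :=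
  ⨆ z, (⊤ : MeasurableSpace (dom x)).comap fun g => g z

theorem measurable_exoMeasure_detMech {x : V} (Z : Set V) (t : ∀ a, dom a) :
    Measurable[detPolicySigma dom x Z] fun g : (∀ z : Z, dom z) → dom x =>
      M.exoMeasure {e | ∀ a, t a = M.detMech Z g a t e} := by
  classical
  let : MeasurableSpace (dom x) := ⊤
  simp_rw [exoMeasure_detMech]
  have hms : MeasurableSet ({t x} : Set (dom x)) := trivial
  have hm : Measurable fun g : (∀ z : Z, dom z) → dom x => g (Z.domRestrict t) :=
    measurable_pi_apply _
  exact Measurable.ite (hm hms) measurable_const measurable_const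

/-- The law of a random deterministic policy that takes, independently at each covariate value, a
random action with the distribution given by a stochastic policy. -/
noncomputable def _root_.PolicySpace.Policy.law {G : CausalDiagram V} {x : V} {R : PolicySpace G x}
    (π : R.Policy dom) : @Measure ((∀ z : R.Pa, dom z) → dom x) (detPolicySigma dom x R.Pa) :=
  @Measure.infinitePi _ _ (fun _ => ⊤) fun z => @PMF.toMeasure _ ⊤ (π z)

/-- A stochastic policy acts as a mixture of deterministic ones. -/
theorem doDist_eq_lintegral {G : CausalDiagram V} {x : V} {R : PolicySpace G x} (π : R.Policy dom)
    (t : ∀ a, dom a) :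
    M.doDist π t =
      ∫⁻ g, M.exoMeasure {e | ∀ a, t a = M.detMech R.Pa g a t e} ∂π.law := by
  classical
  let : MeasurableSpace (dom x) := ⊤
  have hm : Measurable fun g : (∀ z : R.Pa, dom z) → dom x => g (R.Pa.domRestrict t) :=
    measurable_pi_apply _
  have hms : MeasurableSet ({t x} : Set (dom x)) := trivial
  have hset : ∀ g : (∀ z : R.Pa, dom z) → dom x,
      M.exoMeasure {e | ∀ a, t a = M.detMech R.Pa g a t e} =
        ((fun g => g (R.Pa.domRestrict t)) ⁻¹' {t x}).indicator
          (fun _ => M.exoMeasure {e | ∀ a, a ≠ x → M.Satisfies e t a}) g := fun g => by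
    rw [exoMeasure_detMech]; rfl
  have : ∀ z, IsProbabilityMeasure (@PMF.toMeasure _ ⊤ (π z)) := fun z => inferInstance
  simp_rw [hset]
  rw [lintegral_indicator_const (hm hms), doDist, ← Measure.map_apply hm hms]
  congr 1
  have := Measure.infinitePi_map_eval (fun z => @PMF.toMeasure _ ⊤ (π z)) (R.Pa.domRestrict t)
  rw [PolicySpace.Policy.law, this, PMF.toMeasure_apply_singleton _ _ hms]

theorem dist_eq (t : ∀ a, dom a) :
    M.dist t = M.exoMeasure {e | ∀ a, t a = M.mech a t e} := rfl

end POSCM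

/-! ### Transfer from the surrogate to the reward -/

section

variable {V : Type u} {dom : V → Type v} {G : CausalDiagram V} {x : V}

/-- A sum over `K`, split according to the value of `f`. -/
theorem tsum_subtype_eq_tsum_tsum {T : Type u} {σ : Type v} (p : T → ℝ≥0∞) (f : T → σ) (K : Set T) :
    ∑' t : {t // t ∈ K}, p t = ∑' s, ∑' t : {t // t ∈ K ∧ f t = s}, p t := by
  classical
  have h : ∀ s, ∑' t : {t // t ∈ K ∧ f t = s}, p t =
      ∑' t, if s = f t then K.indicator p t else 0 := by
    intro s
    have := tsum_subtype {t | t ∈ K ∧ f t = s} p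
    refine this.trans (tsum_congr fun t => ?_)
    by_cases hK : t ∈ K <;> by_cases hs : s = f t <;>
      simp [Set.indicator, hK, hs, eq_comm]
  simp_rw [h]
  rw [ENNReal.tsum_comm]
  simp_rw [tsum_ite_eq]
  exact tsum_subtype K p

/-- Suppose that under both `p` and `q` the mass of the assignments in `K` that are `s` on `S` is a
factor depending on `s` and the distribution, times a common factor `h K s`. If the marginals over `S`
agree, the first factors agree wherever `h` does not vanish, and hence so do the marginals over `Q`. -/
theorem marginal_eq_of_factor {p q : (∀ a, dom a) → ℝ≥0∞} {S Q : Set V}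
    {a b : (∀ a : S, dom a) → ℝ≥0∞} {h : Set (∀ a, dom a) → (∀ a : S, dom a) → ℝ≥0∞}
    (hmono : ∀ K s, h K s ≤ h Set.univ s) (hfin : ∀ s, h Set.univ s ≠ ⊤)
    (hp : ∀ K : Set (∀ a, dom a), K = Set.univ ∨ (∃ η, K = {t | Q.domRestrict t = η}) → ∀ s,
      ∑' t : {t // t ∈ K ∧ S.domRestrict t = s}, p t = a s * h K s)
    (hq : ∀ K : Set (∀ a, dom a), K = Set.univ ∨ (∃ η, K = {t | Q.domRestrict t = η}) → ∀ s,
      ∑' t : {t // t ∈ K ∧ S.domRestrict t = s}, q t = b s * h K s)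
    (hpq : marginal S p = marginal S q) : marginal Q p = marginal Q q := by
  have huniv : ∀ (p : (∀ a, dom a) → ℝ≥0∞) s,
      ∑' t : {t // t ∈ (Set.univ : Set (∀ a, dom a)) ∧ S.domRestrict t = s}, p t =
        marginal S p s := fun p s =>
    (Equiv.subtypeEquivRight fun t => by simp).tsum_eq
      (fun t : {t // S.domRestrict t = s} => p t)
  have hab : ∀ s, a s * h Set.univ s = b s * h Set.univ s := fun s => by
    rw [← hp _ (.inl rfl), ← hq _ (.inl rfl), huniv, huniv, hpq]
  funext η
  refine (tsum_subtype_eq_tsum_tsum p S.domRestrict {t | Q.domRestrict t = η}).trans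
    (Eq.trans (tsum_congr fun s => ?_)
      (tsum_subtype_eq_tsum_tsum q S.domRestrict {t | Q.domRestrict t = η}).symm)
  rw [hp _ (.inr ⟨η, rfl⟩), hq _ (.inr ⟨η, rfl⟩)]
  by_cases h0 : h Set.univ s = 0
  · have : h {t | Q.domRestrict t = η} s = 0 := le_antisymm (h0 ▸ hmono _ s) zero_le
    rw [this, mul_zero, mul_zero]
  · rw [(ENNReal.mul_left_inj h0 (hfin s)).1 (hab s)]

/-- If the policy reproduces the distribution of a surrogate in a model, then it reproduces the
distribution of the reward in that model. -/
theorem IsSurrogate.marginal_doDist_eq [Finite V] [∀ a, Countable (dom a)]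
    {R : PolicySpace G x} {y : V} {S : Set V} (h : IsSurrogate R y S)
    (hxy : y ∈ G.De x) (M : POSCM.{u, v, w} V dom) (hM : M.diagram = G) (π : R.Policy dom)
    (hS : marginal S (M.doDist π) = marginal S M.dist) :
    marginal {y} (M.doDist π) = marginal {y} M.dist := by
  subst hM
  obtain ⟨B, C, hBC, hSBC, hxC, hyB, hbi, hB, hC⟩ := h.exists_partition hxy
  have hxB : x ∉ B := Set.disjoint_right.1 hBC hxC
  let exo : Set V → Set M.U := fun D => ⋃ a ∈ D, M.exo a
  have hexo : ∀ {D : Set V} {a : V}, a ∈ D → M.exo a ⊆ exo D := fun ha =>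
    Set.subset_biUnion_of_mem (u := M.exo) ha
  have hdisj : Disjoint (exo C) (exo B) := by
    simp only [exo, Set.disjoint_iUnion_left, Set.disjoint_iUnion_right]
    intro a ha b hb
    by_contra hne
    refine hbi a ha b hb ⟨?_, Set.not_disjoint_iff_nonempty_inter.1 hne⟩
    rintro rfl
    exact Set.disjoint_left.1 hBC ha hb
  have hloc : ∀ e a (t t' : ∀ a, dom a), (∀ b, R.Arg b a → t b = t' b) →
      M.mech a t e = M.mech a t' e := fun e a t t' htt => by
    have : (M.pa a).domRestrict t = (M.pa a).domRestrict t' :=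
      funext fun b => htt b (.inl b.2)
    simp only [POSCM.mech, this]
  have hprob : IsProbabilityMeasure M.exoMeasure := inferInstance
  -- the factorization for an arbitrary mechanism `F x` of the action that is driven by disturbances
  -- of `C`; the factor of `B` does not see this mechanism
  have key : ∀ F : ∀ a, (∀ a, dom a) → (∀ i, M.Udom i) → dom a,
      (∀ a, a ≠ x → F a = M.mech a) →
      (∀ e t t', (∀ b, R.Arg b x → t b = t' b) → F x t e = F x t' e) →
      (∀ t c, MeasurableSet[M.exoSigma (exo C)] {e | F x t e = c}) →
      ∀ K : Set (∀ a, dom a), K = Set.univ ∨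
        (∃ η, K = {t | Set.domRestrict {y} t = η}) → ∀ s,
      ∑' t : {t // t ∈ K ∧ S.domRestrict t = s}, M.exoMeasure {e | ∀ a, t.1 a = F a t.1 e} =
        M.exoMeasure (solvableEvent F S C Set.univ s) *
          M.exoMeasure (solvableEvent M.mech S B K s) := by
    intro F hF hFx hFm K hK s
    have hBF : solvableEvent M.mech S B K s = solvableEvent F S B K s := by
      have : ∀ a ∈ B, F a = M.mech a := fun a ha => hF a (by rintro rfl; exact hxB ha)
      ext e
      simp +contextual [solvableEvent, this]
    rw [hBF]
    refine tsum_solution_eq_mul (M.indep_exoSigma hdisj) R.wellFounded_arg ?_ ?_ hBC hSBC ?_ ?_ ?_ hC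
      ?_ s
    · intro e a t t' htt
      by_cases ha : a = x
      · subst ha; exact hFx e t t' htt
      · rw [hF a ha]; exact hloc e a t t' htt
    · intro a t c
      by_cases ha : a = x
      · subst ha; exact M.exoSigma_le _ _ (hFm t c)
      · rw [hF a ha]; exact M.exoSigma_le _ _ (M.measurableSet_mech subset_rfl t c)
    · intro a ha t c
      rw [hF a (by rintro rfl; exact hxB ha)]
      exact M.measurableSet_mech (hexo ha) t c
    · intro a ha t c
      by_cases hax : a = x
      · subst hax; exact hFm t c
      · rw [hF a hax]; exact M.measurableSet_mech (hexo ha) t c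
    · rintro a ha b (hb | ⟨-, rfl⟩)
      · exact hB a ha b hb
      · exact absurd ha hxB
    · rintro t t' htt ht
      rcases hK with rfl | ⟨η, rfl⟩
      · trivial
      · refine Eq.trans (funext ?_) ht
        rintro ⟨_, rfl⟩
        exact (htt _ (.inr hyB)).symm
  refine marginal_eq_of_factor
    (a := fun s => ∫⁻ g, M.exoMeasure (solvableEvent (M.detMech R.Pa g) S C Set.univ s) ∂π.law)
    (b := fun s => M.exoMeasure (solvableEvent M.mech S C Set.univ s))
    (h := fun K s => M.exoMeasure (solvableEvent M.mech S B K s))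
    (fun K s => measure_mono ?_) (fun s => measure_ne_top _ _) (fun K hK s => ?_) (fun K hK s => ?_)
    hS
  · rintro e ⟨t, -, ht⟩
    exact ⟨t, trivial, ht⟩
  · simp_rw [M.doDist_eq_lintegral π]
    rw [← lintegral_tsum, ← lintegral_mul_const' _ _ (measure_ne_top _ _)]
    · refine lintegral_congr fun g => key _ (fun a ha => M.detMech_of_ne ha _ _) ?_ ?_ K hK s
      · intro e t t' htt
        rw [M.detMech_self, M.detMech_self]
        congr 1
        exact funext fun b => htt b (.inr ⟨b.2, rfl⟩)
      · intro t c
        simp_rw [M.detMech_self]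
        exact MeasurableSet.const _
    · intro t
      exact (M.measurable_exoMeasure_detMech _ t).aemeasurable
  · simp_rw [M.dist_eq]
    exact key M.mech (fun _ _ => rfl) (fun e => hloc e x)
      (fun t c => M.measurableSet_mech (hexo hxC) t c) K hK s

end

theorem mainTheorem4 {V : Type u} [Finite V] {dom : V → Type v} [∀ a, Countable (dom a)]
    (G : CausalDiagram V) (x y : V) (hx : x ∈ G.obs) (hy : y ∉ G.obs) (hxy : y ∈ G.De x)
    (R : PolicySpace G x) (P : PMF (∀ a : G.obs, dom a)) (S : Set V) (R' : PolicySpace G x)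
    (h : IsInstrument.{u, v, w} dom R y S R') :
    (PImitable.{u, v, w} R' P S → PImitable.{u, v, w} R P {y}) ∧
      ∀ π : R'.Policy dom, IsImitating.{u, v, w} P S π →
        IsImitating.{u, v, w} P {y} (PolicySpace.extend h.idSubspace.1 π) := by
  have main : ∀ π : R'.Policy dom, IsImitating.{u, v, w} P S π →
      IsImitating.{u, v, w} P {y} (PolicySpace.extend h.idSubspace.1 π) := fun π hπ M hM hP =>
    h.surrogate.marginal_doDist_eq hxy M hM π (hπ M hM hP)
  exact ⟨fun ⟨π, hπ⟩ => ⟨_, main π hπ⟩, main⟩
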